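/- All graphs are finite and simple. A graph is chordal if every cycle of length at least $4$ has a chord. For a graph $G$ let $d$ be the largest cardinality of a clique of $G$. For $i\ge 1$, a dominating $i$-clique of $G$ is a set $\mathcal D$ of cliques of $G$ with exactly $i$ vertices such that every maximal clique of $G$ with at least $i$ vertices contains a member of $\mathcal D$; let $d_i(G)$ be the minimum of $|\mathcal D|$ over all dominating $i$-cliques $\mathcal D$ of $G$. Let $\widetilde\kappa(G)$ be the maximum of $|C\cap C'|$ over all pairs of distinct maximal cliques $C,C'$ of $G$ (and $\widetilde\kappa(G)=0$ if $G$ is complete). Let $G$ be a chordal graph with $n$ vertices, let $K$ be a clique of $G$ of maximum cardinality $d$, and let $\sigma:\{1,\dots,n\}\to V(G)$ be a perfect elimination ordering of $G$ in which the vertices of $K$ come last; that is, $\sigma$ is a bijection, for every vertex $v$ the set $N_\sigma(v)$ of neighbours $u$ of $v$ with $\sigma^{-1}(v)<\sigma^{-1}(u)$ is a clique, and $K=\{x_1,\dots,x_d\}$ with $x_j=\sigma(n-j+1)$. Let $T=\alpha_\sigma(G)$ be the graph with vertex set $V(G)$ whose edges are the images of the edges of $G$ under the following map $\alpha_\sigma$: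 an edge with both ends in $K$ is mapped to itself; and for a vertex $u\notin K$ with $N_\sigma(u)=\{u_1,\dots,u_m\}$, where $\sigma^{-1}(u_1)<\dots<\sigma^{-1}(u_m)$, the edge $uu_j$ is mapped to $ux_j$ for $j=1,\dots,m$. Then (a) $d_i(T)\le d_i(G)$ for every $i=1,\dots,d$; (b) $d_i(T)=d_i(G)$ for every $i>\widetilde\kappa(G)$. -/

import Mathlib

namespace ChordalShift

/-- A graph is chordal if every cycle of length at least four has a chord, that is, an edge of the
graph that joins two vertices of the cycle and is not an edge of the cycle. -/
def IsChordal {V : Type*} (G : SimpleGraph V) : Prop :=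
  ∀ (v : V) (p : G.Walk v v), p.IsCycle → 4 ≤ p.length → ∃ e : Sym2 V, p.IsChord e

/-- A maximal clique: one that is contained in no other clique. -/
def IsMaxlClique {V : Type*} (G : SimpleGraph V) (C : Finset V) : Prop :=
  Maximal (fun S : Finset V => G.IsClique (S : Set V)) C

/-- A dominating `i`-clique: a set `D` of cliques of order `i` such that every maximal clique of
order at least `i` contains a member of `D`. -/
def IsDominating {V : Type*} (G : SimpleGraph V) (i : ℕ) (D : Finset (Finset V)) : Prop :=
  (∀ A ∈ D, G.IsNClique i A) ∧
    ∀ C : Finset V, IsMaxlClique G C → i ≤ C.card → ∃ A ∈ D, A ⊆ C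

/-- The number `d_i(G)`, the least cardinality of a dominating `i`-clique. On a finite vertex set
this is a minimum over a nonempty set, as the set of all `i`-cliques is dominating. -/
noncomputable def domNumber {V : Type*} (G : SimpleGraph V) (i : ℕ) : ℕ :=
  sInf {m : ℕ | ∃ D : Finset (Finset V), IsDominating G i D ∧ D.card = m}

open Classical in
/-- The number `κ̃(G)`, the largest cardinality of the intersection of two distinct maximal cliques.
It is `0` if there is only one maximal clique, that is, if `G` is complete. -/
noncomputable def kappaTilde {V : Type*} (G : SimpleGraph V) : ℕ :=
  sSup {m : ℕ | ∃ C C' : Finset V,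
    IsMaxlClique G C ∧ IsMaxlClique G C' ∧ C ≠ C' ∧ (C ∩ C').card = m}

section Ordering

variable {V : Type*} [Fintype V]

open Classical in
/-- The monotone adjacency set `N_σ(v)`: the neighbours of `v` that come after `v` in the
elimination ordering `σ`. Positions are counted from `0`. -/
noncomputable def monoAdj (G : SimpleGraph V) (σ : Fin (Fintype.card V) ≃ V) (v : V) : Finset V :=
  {u | G.Adj v u ∧ σ.symm v < σ.symm u}

/-- `σ` is a perfect elimination ordering: each vertex `v` is simplicial in the subgraph induced by
`v` and the vertices after it. The neighbourhood of `v` in that subgraph is `N_σ(v)`. -/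
def IsPEO (G : SimpleGraph V) (σ : Fin (Fintype.card V) ≃ V) : Prop :=
  ∀ v : V, G.IsClique (monoAdj G σ v : Set V)

/-- The vertices of `K` come last in `σ`. -/
def EndsWith (σ : Fin (Fintype.card V) ≃ V) (K : Finset V) : Prop :=
  ∀ x ∈ K, ∀ u ∉ K, σ.symm u < σ.symm x

open Classical in
/-- The number of elements of `N_σ(u)` that come before `v`. If
`N_σ(u) = {u_1, u_2, …}` is well ordered and `v = u_i`, this is `i - 1`. -/
noncomputable def idxIn (G : SimpleGraph V) (σ : Fin (Fintype.card V) ≃ V) (u v : V) : ℕ :=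
  ((monoAdj G σ u).filter (fun w => σ.symm w < σ.symm v)).card

theorem idxIn_lt (G : SimpleGraph V) (σ : Fin (Fintype.card V) ≃ V) (u v : V) :
    idxIn G σ u v < Fintype.card V := by
  classical
  unfold idxIn
  exact Finset.card_lt_univ_of_notMem (x := v) (by simp)

/-- The vertex `x_{k+1}`, which is the one in the `k`-th position from the end of `σ` (`k` counted
from `0`). If a clique `K` with `d` elements comes last in `σ`, then `K = {x_1, …, x_d}`. -/
def fromEnd (σ : Fin (Fintype.card V) ≃ V) (k : Fin (Fintype.card V)) : V :=
  σ k.rev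

open Classical in
/-- The image under `α_σ` of an edge `uv` with `u` before `v` in `σ`. If `u` lies in `K` (then so
does `v`, because `K` comes last), the edge is kept. Otherwise `v` is the `i`-th element `u_i` of
the well ordered set `N_σ(u)`, and the edge `u u_i` is sent to `u x_i`. -/
noncomputable def shiftArc (G : SimpleGraph V) (σ : Fin (Fintype.card V) ≃ V) (K : Finset V)
    (u v : V) : Sym2 V :=
  if u ∈ K then s(u, v) else s(u, fromEnd σ ⟨idxIn G σ u v, idxIn_lt G σ u v⟩)

/-- The map `α_σ`, extended to all unordered pairs; it is used on edges of `G` only. -/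
noncomputable def shiftEdge (G : SimpleGraph V) (σ : Fin (Fintype.card V) ≃ V) (K : Finset V) :
    Sym2 V → Sym2 V :=
  Sym2.lift ⟨fun u v => if σ.symm u < σ.symm v then shiftArc G σ K u v else shiftArc G σ K v u, by
    intro u v
    rcases lt_trichotomy (σ.symm u) (σ.symm v) with h | h | h
    · simp [h, not_lt_of_gt h]
    · have huv : u = v := σ.symm.injective h
      subst huv
      rfl
    · simp [h, not_lt_of_gt h]⟩

/-- The combinatorial shift `α_σ(G)`, the graph on the vertices of `G` with edge set
`α_σ(E(G))`. -/
noncomputable def shiftGraph (G : SimpleGraph V) (σ : Fin (Fintype.card V) ≃ V) (K : Finset V) :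
    SimpleGraph V :=
  SimpleGraph.fromEdgeSet (shiftEdge G σ K '' G.edgeSet)

end Ordering

end ChordalShift

/-!
Write `m(u) = |N_σ(u)|` and `c_k` for the number of vertices `u` with `m(u) = k`. The proof compares
both domination numbers with `c_{i-1}`.

* For every perfect elimination ordering, `c_{i-1} ≤ d_i`
  (`card_filter_le_domNumber`). Delete the first vertex `v`. The only maximal clique containing `v`
  is `{v} ∪ N_σ(v)`. If `m(v) = i - 1`, this clique must itself belong to the dominating family and
  it dominates nothing else, so the family loses a member. If `m(v) ≥ i`, the members containing `v`
  can be replaced by one `i`-subset of `N_σ(v)`. If `m(v) < i - 1`, no member contains `v`.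
* The shifted graph `T` joins `u` to exactly those later vertices that are among the last `m(u)`
  (`mem_monoAdj_shiftGraph`). Hence `σ` is a perfect elimination ordering of `T` with the same
  numbers `m(u)`, and `c_{i-1} ≤ d_i(T)`.
* The cliques `{u} ∪ N_σ(u)` with `m(u) = i - 1` form a family of at most `c_{i-1}` members. In `T`
  this family is dominating: a maximal clique is some `{v} ∪ {x_1, …, x_{m(v)}}`, and if `m(v) ≥ i`
  it contains `{x_1, …, x_i}`, the clique of `x_i`. In `G` it is dominating for `i > κ̃(G)`, because
  a maximal clique is then the only one that contains its last `i` vertices.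

Therefore `d_i(T) = c_{i-1} ≤ d_i(G)` for `i ≥ 1`, with equality for `i > κ̃(G)`.
-/

namespace ChordalShift

open Finset

variable {V : Type*}

theorem exists_isMaxlClique_superset [Finite V] {G : SimpleGraph V} {A : Finset V}
    (hA : G.IsClique (A : Set V)) : ∃ C, IsMaxlClique G C ∧ A ⊆ C := by
  obtain ⟨C, hAC, hC⟩ := Set.Finite.exists_le_maximal
    (s := {S : Finset V | G.IsClique (S : Set V)}) (Set.toFinite _) hA
  exact ⟨C, hC, hAC⟩

open Classical in
theorem card_inter_le_kappaTilde [Fintype V] {G : SimpleGraph V} {C C' : Finset V}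
    (hC : IsMaxlClique G C) (hC' : IsMaxlClique G C') (hne : C ≠ C') :
    (C ∩ C').card ≤ kappaTilde G := by
  refine le_csSup ⟨Fintype.card V, ?_⟩ ⟨C, C', hC, hC', hne, by congr⟩
  rintro _ ⟨C, C', -, -, -, rfl⟩
  exact card_le_univ _

theorem domNumber_le {G : SimpleGraph V} {i : ℕ} {D : Finset (Finset V)}
    (hD : IsDominating G i D) : domNumber G i ≤ D.card :=
  Nat.sInf_le ⟨D, hD, rfl⟩

/-- The minimum in the definition of `d_i(G)` is attained. -/
theorem exists_isDominating_card_eq [Fintype V] (G : SimpleGraph V) (i : ℕ) :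
    ∃ D, IsDominating G i D ∧ D.card = domNumber G i := by
  classical
  refine Nat.sInf_mem (s := {m : ℕ | ∃ D, IsDominating G i D ∧ D.card = m})
    ⟨_, ({A | G.IsNClique i A} : Finset (Finset V)), ⟨by simp, fun C hC hi => ?_⟩, rfl⟩
  obtain ⟨A, hAC, hA⟩ := exists_subset_card_eq hi
  exact ⟨A, by simpa using ⟨hC.prop.subset (by exact_mod_cast hAC), hA⟩, hAC⟩

/-! ### Monotone adjacency sets -/

variable [Fintype V]

section Basic

variable {G : SimpleGraph V} {σ : Fin (Fintype.card V) ≃ V}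

theorem mem_monoAdj {u v : V} :
    u ∈ monoAdj G σ v ↔ G.Adj v u ∧ σ.symm v < σ.symm u := by
  simp [monoAdj]

theorem self_notMem_monoAdj (v : V) : v ∉ monoAdj G σ v := by
  simp [mem_monoAdj]

open Classical in
theorem isClique_insert_monoAdj (hσ : IsPEO G σ) (v : V) :
    G.IsClique (insert v (monoAdj G σ v) : Finset V) := by
  rw [coe_insert, SimpleGraph.isClique_insert]
  exact ⟨hσ v, fun u hu _ => (mem_monoAdj.1 hu).1⟩

open Classical in
/-- A clique lies in the closed monotone neighbourhood of any vertex that precedes its other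
vertices. -/
theorem subset_insert_monoAdj {C : Finset V} (hC : G.IsClique (C : Set V)) {v : V} (hv : v ∈ C)
    (hmin : ∀ u ∈ C, σ.symm v ≤ σ.symm u) : C ⊆ insert v (monoAdj G σ v) := by
  intro u hu
  rcases eq_or_ne u v with rfl | hne
  · exact mem_insert_self _ _
  · refine mem_insert_of_mem (mem_monoAdj.2 ⟨hC hv hu hne.symm, (hmin u hu).lt_of_ne ?_⟩)
    exact fun h => hne (σ.symm.injective h).symm

/-- A finite set in which positions are compared through `σ` has, for each `j` below its
cardinality, an element with exactly `j` predecessors in the set. -/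
theorem exists_card_filter_lt_eq (σ : Fin (Fintype.card V) ≃ V) (s : Finset V) {j : ℕ}
    (hj : j < s.card) : ∃ w ∈ s, (s.filter fun x => σ.symm x < σ.symm w).card = j := by
  classical
  have hlt : ∀ w ∈ s, ∀ w' ∈ s, σ.symm w < σ.symm w' →
      (s.filter fun x => σ.symm x < σ.symm w).card <
        (s.filter fun x => σ.symm x < σ.symm w').card := by
    intro w hw w' _ h
    refine card_lt_card ((ssubset_iff_of_subset ?_).2 ⟨w, by simp [hw, h], by simp⟩)
    exact monotone_filter_right s fun x _ hx => lt_trans hx h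
  have hmaps : Set.MapsTo (fun w => (s.filter fun x => σ.symm x < σ.symm w).card) s
      (range s.card) := by
    intro w hw
    have : (s.filter fun x => σ.symm x < σ.symm w).card < s.card :=
      card_lt_card (filter_ssubset.2 ⟨w, hw, by simp⟩)
    simpa using this
  have hinj : Set.InjOn (fun w => (s.filter fun x => σ.symm x < σ.symm w).card) s := by
    intro w hw w' hw' h
    rcases lt_trichotomy (σ.symm w) (σ.symm w') with h' | h' | h'
    · exact absurd h (hlt w hw w' hw' h').ne
    · exact σ.symm.injective h'
    · exact absurd h (hlt w' hw' w hw h').ne'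
  have := surjOn_of_injOn_of_card_le _ hmaps hinj (by simp)
  obtain ⟨w, hw, h⟩ := this (by simpa using hj : j ∈ (range s.card : Set ℕ))
  exact ⟨w, hw, h⟩

end Basic

/-! ### The lower bound for a perfect elimination ordering -/

open Classical in
/-- The lower bound for the subgraph induced by a final segment `S` of the ordering, by induction on
`S`. -/
theorem card_filter_le_card_of_dominates {G : SimpleGraph V} {σ : Fin (Fintype.card V) ≃ V}
    (hσ : IsPEO G σ) (k : ℕ) (S : Finset V) (hS : ∀ u ∈ S, monoAdj G σ u ⊆ S)
    (D : Finset (Finset V)) (hD : ∀ A ∈ D, A ⊆ S ∧ A.card = k + 1 ∧ G.IsClique (A : Set V))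
    (hdom : ∀ C, Maximal (fun A : Finset V => A ⊆ S ∧ G.IsClique (A : Set V)) C →
      k + 1 ≤ C.card → ∃ A ∈ D, A ⊆ C) :
    (S.filter fun u => (monoAdj G σ u).card = k).card ≤ D.card := by
  induction hn : S.card generalizing S D with
  | zero => simp [card_eq_zero.1 hn]
  | succ n ih =>
    obtain ⟨v, hvS, hmin⟩ := S.exists_min_image σ.symm (card_pos.1 (by omega))
    set N := monoAdj G σ v with hN
    have hvN : v ∉ N := self_notMem_monoAdj v
    have hNS : N ⊆ S.erase v := subset_erase.2 ⟨hS v hvS, hvN⟩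
    have hsub : ∀ C : Finset V, C ⊆ S → G.IsClique (C : Set V) → v ∈ C → C ⊆ insert v N :=
      fun C hCS hC hv => subset_insert_monoAdj hC hv fun u hu => hmin u (hCS hu)
    have hmaxN : Maximal (fun A : Finset V => A ⊆ S ∧ G.IsClique (A : Set V)) (insert v N) :=
      ⟨⟨insert_subset hvS (hS v hvS), isClique_insert_monoAdj hσ v⟩,
        fun C hC hle => hsub C hC.1 hC.2 (hle (mem_insert_self v N))⟩
    -- Apart from `N`, deleting `v` creates no new maximal cliques.
    have hmax : ∀ C, Maximal (fun A : Finset V => A ⊆ S.erase v ∧ G.IsClique (A : Set V)) C →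
        C ≠ N → Maximal (fun A : Finset V => A ⊆ S ∧ G.IsClique (A : Set V)) C := by
      intro C hC hne
      refine ⟨⟨hC.prop.1.trans (erase_subset _ _), hC.prop.2⟩, fun C' hC' hle => ?_⟩
      by_cases hv : v ∈ C'
      · have hCN : C ⊆ N := by
          intro u hu
          have huv : u ≠ v := (mem_erase.1 (hC.prop.1 hu)).1
          exact (mem_insert.1 (hsub C' hC'.1 hC'.2 hv (hle hu))).resolve_left huv
        exact absurd (hC.eq_of_le ⟨hNS, hσ v⟩ hCN) hne
      · exact hC.le_of_ge ⟨subset_erase.2 ⟨hC'.1, hv⟩, hC'.2⟩ hle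
    have hS' : ∀ u ∈ S.erase v, monoAdj G σ u ⊆ S.erase v := by
      intro u hu
      refine subset_erase.2 ⟨hS u (mem_of_mem_erase hu), fun hv => ?_⟩
      exact absurd (mem_monoAdj.1 hv).2 (hmin u (mem_of_mem_erase hu)).not_gt
    have hcard : (S.erase v).card = n := by rw [card_erase_of_mem hvS, hn]; rfl
    have hvC : ∀ C, C ⊆ S.erase v → v ∉ C := fun C hC hv => notMem_erase v S (hC hv)
    have hcardN : (insert v N).card = N.card + 1 := card_insert_of_notMem hvN
    have hfilter : N.card ≠ k → (S.filter fun u => (monoAdj G σ u).card = k) =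
        ((S.erase v).filter fun u => (monoAdj G σ u).card = k) := by
      intro hk
      rw [filter_erase, erase_eq_of_notMem]
      simp [← hN, hk]
    rcases lt_trichotomy N.card k with hk | hk | hk
    · rw [hfilter hk.ne]
      refine ih _ hS' D (fun A hA => ⟨subset_erase.2 ⟨(hD A hA).1, fun hv => ?_⟩, (hD A hA).2⟩)
        (fun C hC hCk => hdom C (hmax C hC ?_) hCk) hcard
      · have := card_le_card (hsub A (hD A hA).1 (hD A hA).2.2 hv)
        have := (hD A hA).2.1
        omega
      · rintro rfl
        omega
    · have heq : ∀ A ∈ D, A ⊆ insert v N → A = insert v N := fun A hA hle =>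
        eq_of_subset_of_card_le hle (by rw [(hD A hA).2.1]; omega)
      have hmem : insert v N ∈ D := by
        obtain ⟨A, hA, hle⟩ := hdom _ hmaxN (by omega)
        exact heq A hA hle ▸ hA
      have hle := ih _ hS' (D.erase (insert v N))
        (fun A hA => ?_) (fun C hC hCk => ?_) hcard
      · rw [card_erase_of_mem hmem, filter_erase,
          card_erase_of_mem (mem_filter.2 ⟨hvS, hk⟩)] at hle
        have := card_pos.2 ⟨_, hmem⟩
        omega
      · obtain ⟨hne, hA⟩ := mem_erase.1 hA
        exact ⟨subset_erase.2 ⟨(hD A hA).1, fun hv =>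
          hne (heq A hA (hsub A (hD A hA).1 (hD A hA).2.2 hv))⟩, (hD A hA).2⟩
      · obtain ⟨A, hA, hAC⟩ := hdom C (hmax C hC (by rintro rfl; omega)) hCk
        refine ⟨A, mem_erase.2 ⟨?_, hA⟩, hAC⟩
        rintro rfl
        exact hvC C hC.prop.1 (hAC (mem_insert_self v N))
    · rw [hfilter hk.ne']
      obtain ⟨B, hBN, hB⟩ := exists_subset_card_eq (Nat.succ_le_of_lt hk)
      refine (ih _ hS' (D.image fun A => if v ∈ A then B else A)
        (fun A hA => ?_) (fun C hC hCk => ?_) hcard).trans card_image_le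
      · obtain ⟨A, hAD, rfl⟩ := mem_image.1 hA
        split_ifs with hv
        · exact ⟨hBN.trans hNS, hB, (hσ v).subset (by exact_mod_cast hBN)⟩
        · exact ⟨subset_erase.2 ⟨(hD A hAD).1, hv⟩, (hD A hAD).2⟩
      · by_cases hCN : C = N
        · obtain ⟨A, hA, hle⟩ := hdom _ hmaxN (by omega)
          refine ⟨_, mem_image_of_mem _ hA, ?_⟩
          split_ifs with hv
          · exact hCN ▸ hBN
          · exact hCN ▸ (subset_insert_iff_of_notMem hv).1 hle
        · obtain ⟨A, hA, hAC⟩ := hdom C (hmax C hC hCN) hCk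
          refine ⟨_, mem_image_of_mem _ hA, ?_⟩
          rw [if_neg fun hv => hvC C hC.prop.1 (hAC hv)]
          exact hAC

theorem card_filter_le_domNumber {G : SimpleGraph V} {σ : Fin (Fintype.card V) ≃ V}
    (hσ : IsPEO G σ) (k : ℕ) :
    (univ.filter fun u => (monoAdj G σ u).card = k).card ≤ domNumber G (k + 1) := by
  obtain ⟨D, hD, hcard⟩ := exists_isDominating_card_eq G (k + 1)
  rw [← hcard]
  convert card_filter_le_card_of_dominates hσ k univ (fun _ _ => subset_univ _) D
    (fun A hA => ⟨subset_univ _, (hD.1 A hA).card_eq, (hD.1 A hA).isClique⟩)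
    (fun C hC => hD.2 C ?_)
  simpa [IsMaxlClique] using hC

/-! ### Upper bounds from closed monotone neighbourhoods -/

open Classical in
/-- The closed monotone neighbourhoods with `k + 1` elements give an upper bound for `d_{k+1}` as
soon as they dominate. -/
theorem domNumber_le_card_filter {G : SimpleGraph V} {σ : Fin (Fintype.card V) ≃ V}
    (hσ : IsPEO G σ) (k : ℕ)
    (h : ∀ C, IsMaxlClique G C → k + 1 ≤ C.card →
      ∃ u, (monoAdj G σ u).card = k ∧ insert u (monoAdj G σ u) ⊆ C) :
    domNumber G (k + 1) ≤ (univ.filter fun u => (monoAdj G σ u).card = k).card := by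
  refine (domNumber_le (D := (univ.filter fun u => (monoAdj G σ u).card = k).image
    fun u => insert u (monoAdj G σ u)) ⟨fun A hA => ?_, fun C hC hk => ?_⟩).trans card_image_le
  · obtain ⟨u, hu, rfl⟩ := mem_image.1 hA
    refine ⟨isClique_insert_monoAdj hσ u, ?_⟩
    rw [card_insert_of_notMem (self_notMem_monoAdj u), (mem_filter.1 hu).2]
  · obtain ⟨u, hu, hC⟩ := h C hC hk
    exact ⟨_, mem_image_of_mem _ (by simpa using hu), hC⟩

/-- If `k + 1 > κ̃(G)`, then the `(k+1)`-st vertex from the end of a maximal clique `C` has exactly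
`k` later neighbours, all of them in `C`. -/
theorem domNumber_le_card_filter_of_kappaTilde_lt {G : SimpleGraph V}
    {σ : Fin (Fintype.card V) ≃ V} (hσ : IsPEO G σ) {k : ℕ} (hk : kappaTilde G < k + 1) :
    domNumber G (k + 1) ≤ (univ.filter fun u => (monoAdj G σ u).card = k).card := by
  classical
  refine domNumber_le_card_filter hσ k fun C hC hCk => ?_
  -- Having `|C| - (k + 1)` predecessors in `C` means having `k` successors.
  obtain ⟨u, huC, hu⟩ := exists_card_filter_lt_eq σ C (j := C.card - (k + 1)) (by omega)
  set E := C.filter fun x => ¬ σ.symm x < σ.symm u with hE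
  have hge : E.card = k + 1 := by
    have := card_filter_add_card_filter_not (s := C) fun x => σ.symm x < σ.symm u
    rw [← hE] at this
    omega
  have hEN : E ⊆ insert u (monoAdj G σ u) :=
    subset_insert_monoAdj (hC.prop.subset (by exact_mod_cast filter_subset _ _))
      (by simp [hE, huC]) (fun x hx => not_lt.1 (mem_filter.1 hx).2)
  obtain ⟨C', hC', hN⟩ := exists_isMaxlClique_superset (isClique_insert_monoAdj hσ u)
  have hCC : C = C' := by
    by_contra hne
    have h1 := card_inter_le_kappaTilde hC hC' hne
    have h2 : E.card ≤ (C ∩ C').card :=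
      card_le_card (subset_inter (filter_subset _ _) (hEN.trans hN))
    omega
  subst hCC
  have hNE : insert u (monoAdj G σ u) = E := by
    refine Subset.antisymm (fun x hx => mem_filter.2 ⟨hN hx, ?_⟩) hEN
    rcases mem_insert.1 hx with rfl | hx
    · exact lt_irrefl _
    · exact (mem_monoAdj.1 hx).2.not_gt
  refine ⟨u, ?_, hN⟩
  rw [← hNE, card_insert_of_notMem (self_notMem_monoAdj u)] at hge
  omega

/-! ### The shifted graph -/

theorem fromEnd_eq_iff {σ : Fin (Fintype.card V) ≃ V} {j : Fin (Fintype.card V)} {v : V} :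
    fromEnd σ j = v ↔ (j : ℕ) = (σ.symm v).rev := by
  rw [fromEnd, ← Equiv.eq_symm_apply, ← Fin.ext_iff, Fin.rev_eq_iff]

theorem card_filter_rev_lt (σ : Fin (Fintype.card V) ≃ V) {m : ℕ} (hm : m ≤ Fintype.card V) :
    (univ.filter fun v => ((σ.symm v).rev : ℕ) < m).card = m := by
  have : (univ.filter fun v => ((σ.symm v).rev : ℕ) < m) =
      (univ.filter fun j : Fin (Fintype.card V) => (j : ℕ) < m).map
        (Fin.revPerm.trans σ).toEmbedding := by
    ext v
    simp only [mem_filter, mem_univ, true_and, mem_map_equiv]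
    simp
  rw [this, card_map, Fin.card_filter_val_lt, min_eq_right hm]

section Shift

variable {G : SimpleGraph V} {σ : Fin (Fintype.card V) ≃ V} {K : Finset V}

/-- A set of vertices that comes last consists of the last `|K|` vertices. -/
theorem mem_iff_rev_lt_card (hσK : EndsWith σ K) {v : V} :
    v ∈ K ↔ ((σ.symm v).rev : ℕ) < K.card := by
  constructor
  · intro hv
    have hsub : (univ.filter fun w => ((σ.symm w).rev : ℕ) < (σ.symm v).rev + 1) ⊆ K := by
      intro w hw
      by_contra hwK
      have h := Fin.rev_lt_rev.2 (hσK v hv w hwK)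
      rw [Fin.lt_def] at h
      have := (mem_filter.1 hw).2
      omega
    have := card_le_card hsub
    rw [card_filter_rev_lt σ (σ.symm v).rev.isLt] at this
    omega
  · intro h
    by_contra hv
    have hsub : K ⊆ (univ.filter fun w => ((σ.symm w).rev : ℕ) < (σ.symm v).rev) := by
      intro w hw
      exact mem_filter.2 ⟨mem_univ w, Fin.rev_lt_rev.2 (hσK w hw v hv)⟩
    have := card_le_card hsub
    rw [card_filter_rev_lt σ (σ.symm v).rev.isLt.le] at this
    omega

theorem card_monoAdj_lt (hK : G.IsMaximumClique K) (hσ : IsPEO G σ) (u : V) :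
    (monoAdj G σ u).card < K.card := by
  classical
  have := hK.maximum _ (isClique_insert_monoAdj hσ u)
  rw [card_insert_of_notMem (self_notMem_monoAdj u)] at this
  omega

theorem mem_of_symm_lt (hσK : EndsWith σ K) {u v : V} (hu : u ∈ K)
    (h : σ.symm u < σ.symm v) : v ∈ K := by
  by_contra hv
  exact absurd (hσK u hu v hv) h.not_gt

/-- The vertex `x_j` has `j - 1` later neighbours. -/
theorem card_monoAdj_of_mem (hK : G.IsClique (K : Set V)) (hσK : EndsWith σ K) {u : V}
    (hu : u ∈ K) : (monoAdj G σ u).card = (σ.symm u).rev := by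
  rw [← card_filter_rev_lt σ (σ.symm u).rev.isLt.le]
  congr 1
  ext v
  simp only [mem_monoAdj, mem_filter, mem_univ, true_and, ← Fin.lt_def, Fin.rev_lt_rev]
  refine ⟨And.right, fun h => ⟨hK hu (mem_of_symm_lt hσK hu h) ?_, h⟩⟩
  rintro rfl
  exact h.false

/-- The last `|N_σ(u)|` vertices all come after `u`. -/
theorem symm_lt_of_rev_lt_card (hK : G.IsMaximumClique K) (hσ : IsPEO G σ) (hσK : EndsWith σ K)
    {u v : V} (h : ((σ.symm v).rev : ℕ) < (monoAdj G σ u).card) : σ.symm u < σ.symm v := by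
  by_cases hu : u ∈ K
  · rw [card_monoAdj_of_mem hK.isClique hσK hu] at h
    exact Fin.rev_lt_rev.1 h
  · exact hσK v ((mem_iff_rev_lt_card hσK).2 (h.trans (card_monoAdj_lt hK hσ u))) u hu

/-- The shifted graph joins `u` to the last `|N_σ(u)|` vertices and to no other later vertex. -/
theorem mem_monoAdj_shiftGraph (hK : G.IsMaximumClique K) (hσ : IsPEO G σ) (hσK : EndsWith σ K)
    {u v : V} : v ∈ monoAdj (shiftGraph G σ K) σ u ↔
      ((σ.symm v).rev : ℕ) < (monoAdj G σ u).card := by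
  rw [mem_monoAdj, shiftGraph, SimpleGraph.fromEdgeSet_adj]
  constructor
  · rintro ⟨⟨⟨e, he, hse⟩, -⟩, huv⟩
    -- Orient the edge so that its first end comes first.
    obtain ⟨a, b, hab, hlt, harc⟩ : ∃ a b, G.Adj a b ∧ σ.symm a < σ.symm b ∧
        shiftArc G σ K a b = s(u, v) := by
      induction e with
      | h a b =>
        rcases lt_or_gt_of_ne fun h => (G.ne_of_adj he) (σ.symm.injective h) with h | h
        · exact ⟨a, b, he, h, by simpa [shiftEdge, h] using hse⟩
        · exact ⟨b, a, SimpleGraph.Adj.symm he, h, by simpa [shiftEdge, h.not_gt] using hse⟩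
    rw [shiftArc] at harc
    split_ifs at harc with haK
    · rcases Sym2.eq_iff.1 harc with ⟨rfl, rfl⟩ | ⟨rfl, rfl⟩
      · rw [card_monoAdj_of_mem hK.isClique hσK haK]
        exact Fin.rev_lt_rev.2 huv
      · exact absurd huv hlt.not_gt
    · have hidx : idxIn G σ a b < (monoAdj G σ a).card :=
        card_lt_card (filter_ssubset.2 ⟨b, mem_monoAdj.2 ⟨hab, hlt⟩, lt_irrefl _⟩)
      rcases Sym2.eq_iff.1 harc with ⟨rfl, h⟩ | ⟨rfl, h⟩
      · rwa [← fromEnd_eq_iff.1 h]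
      · have hrev : idxIn G σ a b = (σ.symm u).rev := fromEnd_eq_iff.1 h
        rw [hrev] at hidx
        exact absurd huv (symm_lt_of_rev_lt_card hK hσ hσK hidx).not_gt
  · intro h
    have huv := symm_lt_of_rev_lt_card hK hσ hσK h
    have hne : u ≠ v := by
      rintro rfl
      exact huv.false
    refine ⟨⟨?_, hne⟩, huv⟩
    by_cases hu : u ∈ K
    · refine ⟨s(u, v), hK.isClique hu (mem_of_symm_lt hσK hu huv) hne, ?_⟩
      simp [shiftEdge, huv, shiftArc, hu]
    · obtain ⟨w, hw, hidx⟩ := exists_card_filter_lt_eq σ _ h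
      obtain ⟨hadj, hlt⟩ := mem_monoAdj.1 hw
      refine ⟨s(u, w), hadj, ?_⟩
      have : fromEnd σ ⟨idxIn G σ u w, idxIn_lt G σ u w⟩ = v := by
        rw [fromEnd_eq_iff, ← hidx]
        unfold idxIn
        congr!
      simp [shiftEdge, hlt, shiftArc, hu, this]

theorem card_monoAdj_shiftGraph (hK : G.IsMaximumClique K) (hσ : IsPEO G σ) (hσK : EndsWith σ K)
    (u : V) : (monoAdj (shiftGraph G σ K) σ u).card = (monoAdj G σ u).card := by
  rw [← card_filter_rev_lt σ (card_le_univ (monoAdj G σ u))]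
  congr 1
  ext v
  simp [mem_monoAdj_shiftGraph hK hσ hσK]

theorem isPEO_shiftGraph (hK : G.IsMaximumClique K) (hσ : IsPEO G σ) (hσK : EndsWith σ K) :
    IsPEO (shiftGraph G σ K) σ := by
  have hadj : ∀ a ∈ K, ∀ b, σ.symm a < σ.symm b → (shiftGraph G σ K).Adj a b := by
    intro a ha b hab
    refine (mem_monoAdj.1 ((mem_monoAdj_shiftGraph hK hσ hσK).2 ?_)).1
    rw [card_monoAdj_of_mem hK.isClique hσK ha]
    exact Fin.rev_lt_rev.2 hab
  have hmem : ∀ u, ∀ a ∈ monoAdj (shiftGraph G σ K) σ u, a ∈ K := fun u a ha =>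
    (mem_iff_rev_lt_card hσK).2
      (((mem_monoAdj_shiftGraph hK hσ hσK).1 ha).trans (card_monoAdj_lt hK hσ u))
  intro u a ha b hb hne
  rcases lt_or_gt_of_ne fun h => hne (σ.symm.injective h) with h | h
  · exact hadj a (hmem u a ha) b h
  · exact (hadj b (hmem u b hb) a h).symm

theorem domNumber_shiftGraph_le_card_filter (hK : G.IsMaximumClique K) (hσ : IsPEO G σ)
    (hσK : EndsWith σ K) (k : ℕ) : domNumber (shiftGraph G σ K) (k + 1) ≤
      (univ.filter fun u => (monoAdj (shiftGraph G σ K) σ u).card = k).card := by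
  classical
  have hpeo := isPEO_shiftGraph hK hσ hσK
  refine domNumber_le_card_filter hpeo k fun C hC hCk => ?_
  obtain ⟨v, hvC, hmin⟩ := C.exists_min_image σ.symm (card_pos.1 (by omega))
  have hCeq : C = insert v (monoAdj (shiftGraph G σ K) σ v) :=
    hC.eq_of_le (isClique_insert_monoAdj hpeo v) (subset_insert_monoAdj hC.prop hvC hmin)
  have hcard : C.card = (monoAdj G σ v).card + 1 := by
    rw [hCeq, card_insert_of_notMem (self_notMem_monoAdj v), card_monoAdj_shiftGraph hK hσ hσK]
  rcases (show k ≤ (monoAdj G σ v).card by omega).eq_or_lt with hk | hk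
  · exact ⟨v, by rw [card_monoAdj_shiftGraph hK hσ hσK, hk], hCeq.ge⟩
  · -- The witness is `x_{k+1}`, whose closed monotone neighbourhood is `{x_1, …, x_{k+1}}`.
    have hkV := hk.trans_le (card_le_univ _)
    obtain ⟨x, hx⟩ : ∃ x, k = (σ.symm x).rev :=
      ⟨fromEnd σ ⟨k, hkV⟩, fromEnd_eq_iff (j := ⟨k, hkV⟩).1 rfl⟩
    have hxK : x ∈ K :=
      (mem_iff_rev_lt_card hσK).2 (hx ▸ hk.trans (card_monoAdj_lt hK hσ v))
    have hxk : (monoAdj G σ x).card = k := by rw [card_monoAdj_of_mem hK.isClique hσK hxK, hx]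
    refine ⟨x, by rw [card_monoAdj_shiftGraph hK hσ hσK, hxk], ?_⟩
    rw [hCeq]
    refine (insert_subset ?_ fun w hw => ?_).trans (subset_insert _ _)
    · exact (mem_monoAdj_shiftGraph hK hσ hσK).2 (hx ▸ hk)
    · rw [mem_monoAdj_shiftGraph hK hσ hσK, hxk] at hw
      exact (mem_monoAdj_shiftGraph hK hσ hσK).2 (hw.trans hk)

theorem domNumber_shiftGraph (hK : G.IsMaximumClique K) (hσ : IsPEO G σ) (hσK : EndsWith σ K)
    (k : ℕ) : domNumber (shiftGraph G σ K) (k + 1) =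
      (univ.filter fun u => (monoAdj G σ u).card = k).card := by
  have h := (domNumber_shiftGraph_le_card_filter hK hσ hσK k).antisymm
    (card_filter_le_domNumber (isPEO_shiftGraph hK hσ hσK) k)
  simpa only [card_monoAdj_shiftGraph hK hσ hσK] using h

end Shift

end ChordalShift

theorem mainTheorem3 {V : Type*} [Fintype V] (G : SimpleGraph V)
    (hG : ChordalShift.IsChordal G)
    (K : Finset V) (hK : G.IsMaximumClique K)
    (σ : Fin (Fintype.card V) ≃ V) (hσ : ChordalShift.IsPEO G σ)
    (hσK : ChordalShift.EndsWith σ K) :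
    (∀ i : ℕ, 1 ≤ i → i ≤ G.cliqueNum →
      ChordalShift.domNumber (ChordalShift.shiftGraph G σ K) i ≤ ChordalShift.domNumber G i) ∧
    (∀ i : ℕ, ChordalShift.kappaTilde G < i →
      ChordalShift.domNumber (ChordalShift.shiftGraph G σ K) i = ChordalShift.domNumber G i) := by
  constructor
  · intro i hi _
    obtain ⟨k, rfl⟩ := Nat.exists_eq_add_of_le' hi
    rw [ChordalShift.domNumber_shiftGraph hK hσ hσK]
    exact ChordalShift.card_filter_le_domNumber hσ k
  · intro i hi
    obtain ⟨k, rfl⟩ := Nat.exists_eq_add_of_le' (Nat.one_le_of_lt hi)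
    rw [ChordalShift.domNumber_shiftGraph hK hσ hσK]
    exact (ChordalShift.card_filter_le_domNumber hσ k).antisymm
      (ChordalShift.domNumber_le_card_filter_of_kappaTilde_lt hσ hi)
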